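/- For every integer $n\ge 1$ the following hold. (i) $\displaystyle \zeta(2n)=\frac{(-1)^{n+1}(2\pi)^{2n}B_{2n}}{2\,(2n)!}$, and this real number is irrational. (ii) $\displaystyle L(2n+1,\chi)=\frac{(-1)^{n}\pi^{2n+1}E_{2n}}{2^{2n+2}\,(2n)!}$, and this real number is irrational. Here $\zeta$ is the Riemann zeta function; $\chi$ is the quadratic Dirichlet character modulo $4$, given by $\chi(4m+1)=1$, $\chi(4m+3)=-1$, $\chi(2m)=0$; $L(s,\chi)=\sum_{k\ge1}\chi(k)k^{-s}$; the $B_k$ are the Bernoulli numbers, $\frac{t}{e^t-1}=\sum_{k\ge0}B_k\frac{t^k}{k!}$; and the $E_k$ are the (signed) Euler numbers, $\frac{1}{\cosh t}=\sum_{k\ge0}E_k\frac{t^k}{k!}$. -/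

import Mathlib

open scoped Nat

/-- The hyperbolic cosine as a formal power series, `cosh t = ∑ t ^ (2 m) / (2 m)!`. -/
noncomputable def coshSeries : PowerSeries ℚ :=
  PowerSeries.mk fun k => if Even k then 1 / (k ! : ℚ) else 0

/-- The (signed) Euler numbers, `1 / cosh t = ∑ E_k t ^ k / k !`, so that
`E_0 = 1`, `E_2 = -1`, `E_4 = 5`, `E_6 = -61` and the odd ones vanish. -/
noncomputable def eulerNumber (k : ℕ) : ℚ :=
  (k ! : ℚ) * PowerSeries.coeff k coshSeries⁻¹

/-- The quadratic Dirichlet character modulo `4` with complex values: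
`χ(4m+1) = 1`, `χ(4m+3) = -1`, `χ(2m) = 0`. -/
noncomputable def quadraticChar4 : DirichletCharacter ℂ 4 :=
  ZMod.χ₄.ringHomComp (Int.castRingHom ℂ)

/-! Both values are rational multiples of a positive power of π. The rational factors are nonzero
because ζ and L(·, χ) do not vanish for Re s > 1, so irrationality follows from `transcendental_pi`.
That rests on Lindemann's argument: if exp α = -1 with α algebraic, expanding ∏ (1 + exp b) = 0 over
the conjugates b of α gives a vanishing sum of exponentials over a Galois-stable multiset, which a
Hermite approximation excludes (`natCast_add_sum_exp_aroots_ne_zero`). The L-value is the Fourier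
series of a Bernoulli polynomial at 1/4, evaluated by `bernoulli_eval_one_quarter`. -/

/-! ### Galois descent for multisets of algebraic numbers -/

section GaloisInvariant

open Polynomial

variable {A : Type*} [Field A] [Algebra ℚ A]

lemma exists_polynomial_aroots_eq_of_galois_invariant [IsGalois ℚ A] (M : Multiset A)
    (hM : ∀ σ : A ≃ₐ[ℚ] A, M.map σ = M) : ∃ f : ℤ[X], f ≠ 0 ∧ f.aroots A = M := by
  obtain ⟨Q, hQ⟩ : (M.map fun a => X - C a).prod ∈ lifts (algebraMap ℚ A) := by
    rw [lifts_iff_coeff_lifts]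
    intro n
    rw [InfiniteGalois.mem_range_algebraMap_iff_fixed]
    intro σ
    change (σ : A →+* A) _ = _
    rw [← coeff_map, Polynomial.map_multiset_prod, Multiset.map_map]
    conv_rhs => rw [← hM σ, Multiset.map_map]
    simp
  have hmonic : (M.map fun a => X - C a).prod.Monic :=
    monic_multiset_prod_of_monic _ _ fun a _ => monic_X_sub_C a
  have hQ' : Q.map (algebraMap ℚ A) = (M.map fun a => X - C a).prod := hQ
  obtain ⟨b, hb, hbQ⟩ := IsLocalization.integerNormalization_spec (nonZeroDivisors ℤ) Q
  have hmap : (IsLocalization.integerNormalization (nonZeroDivisors ℤ) Q).map (algebraMap ℤ A)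
      = C (algebraMap ℤ A b) * (M.map fun a => X - C a).prod := by
    rw [← hQ', IsScalarTower.algebraMap_eq ℤ ℚ A, ← Polynomial.map_map]
    rw [hbQ]
    ext i
    simp
  have hb0 : algebraMap ℤ A b ≠ 0 := by
    have := Algebra.charZero_of_charZero ℚ A
    simpa using nonZeroDivisors.ne_zero hb
  refine ⟨IsLocalization.integerNormalization (nonZeroDivisors ℤ) Q, ?_, ?_⟩
  · intro h
    rw [h, Polynomial.map_zero] at hmap
    exact mul_ne_zero (C_ne_zero.2 hb0) hmonic.ne_zero hmap.symm
  · rw [aroots, hmap, roots_C_mul _ hb0, roots_multiset_prod_X_sub_C]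

lemma exists_int_of_isIntegral_of_galois_fixed [IsGalois ℚ A] {x : A} (hx : IsIntegral ℤ x)
    (hfix : ∀ σ : A ≃ₐ[ℚ] A, σ x = x) : ∃ z : ℤ, (z : A) = x := by
  obtain ⟨q, rfl⟩ := (InfiniteGalois.mem_range_algebraMap_iff_fixed x).2 hfix
  rw [isIntegral_algebraMap_iff (algebraMap ℚ A).injective] at hx
  obtain ⟨z, rfl⟩ := IsIntegrallyClosed.isIntegral_iff.1 hx
  exact ⟨z, by simp⟩

/-- The leading coefficient times a root is integral, and the factor to the power `D` supplies one
copy for each power of `r`. -/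
lemma isIntegral_leadingCoeff_pow_mul_aeval {A : Type*} [Field A] {f g : ℤ[X]} {D : ℕ} (hg : g.natDegree ≤ D) {r : A}
    (hr : aeval r f = 0) : IsIntegral ℤ ((f.leadingCoeff : A) ^ D * aeval r g) := by
  have hlc : IsIntegral ℤ ((f.leadingCoeff : A) * r) := by
    simpa using isIntegral_leadingCoeff_smul f r hr
  rw [aeval_eq_sum_range' (Nat.lt_succ_of_le hg), Finset.mul_sum]
  refine IsIntegral.sum _ fun i hi => ?_
  have hi : i ≤ D := by simpa [Nat.lt_succ_iff] using hi
  have : (f.leadingCoeff : A) ^ D * g.coeff i • r ^ i =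
      ((g.coeff i * f.leadingCoeff ^ (D - i) : ℤ) : A) * (f.leadingCoeff * r) ^ i := by
    obtain ⟨j, rfl⟩ := Nat.exists_eq_add_of_le hi
    simp only [zsmul_eq_mul, Nat.add_sub_cancel_left]
    push_cast
    ring
  rw [this]
  exact (isIntegral_algebraMap (R := ℤ) (A := A)).mul (hlc.pow i)

lemma map_aroots_int (f : ℤ[X]) (hf : (f.map (algebraMap ℤ A)).Splits) (σ : A ≃ₐ[ℚ] A) :
    (f.aroots A).map σ = f.aroots A := by
  have := hf.roots_map (σ : A →+* A)
  rw [Polynomial.map_map, RingHom.ext_int ((σ : A →+* A).comp (algebraMap ℤ A))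
    (algebraMap ℤ A)] at this
  exact this.symm

lemma exists_int_sum_aeval_aroots (A : Type*) [Field A] [Algebra ℚ A] [IsAlgClosure ℚ A]
    [Algebra A ℂ] (f g : ℤ[X]) {D : ℕ} (hg : g.natDegree ≤ D) :
    ∃ z : ℤ, (z : ℂ) = (f.leadingCoeff : ℂ) ^ D * ((f.aroots ℂ).map fun r => aeval r g).sum := by
  have hsplit : (f.map (algebraMap ℤ A)).Splits := by
    have := IsAlgClosure.isAlgClosed ℚ (K := A)
    exact IsAlgClosed.splits _
  obtain ⟨z, hz⟩ := exists_int_of_isIntegral_of_galois_fixed (A := A)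
    (x := (f.leadingCoeff : A) ^ D *
      ((f.aroots A).map fun r => aeval r g).sum) (by
      rw [← Multiset.sum_map_mul_left]
      refine IsIntegral.multiset_sum fun y hy => ?_
      obtain ⟨r, hr, rfl⟩ := Multiset.mem_map.1 hy
      exact isIntegral_leadingCoeff_pow_mul_aeval hg (mem_aroots'.1 hr).2) (by
      intro σ
      rw [map_mul, map_pow, map_intCast, map_multiset_sum, Multiset.map_map]
      conv_rhs => rw [← map_aroots_int f hsplit σ, Multiset.map_map]
      congr 3
      ext r
      simpa using map_aeval_eq_aeval_map (ψ := (σ : A →+* A))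
        (RingHom.ext_int ((algebraMap ℤ A).comp (RingHom.id ℤ)) _) g r)
  refine ⟨z, ?_⟩
  have := congrArg (algebraMap A ℂ) hz
  rw [map_intCast, map_mul, map_pow, map_intCast, map_multiset_sum, Multiset.map_map] at this
  rw [this, ← hsplit.map_aroots_algebraMap (B := ℂ), Multiset.map_map]
  congr 3
  ext r
  simp only [Function.comp_apply]
  rw [aeval_algebraMap_apply]

end GaloisInvariant

/-! ### Lindemann's theorem for π -/

section Exponential

open Polynomial Filter

lemma tendsto_pow_div_factorial_pred (c : ℝ) :
    Tendsto (fun n : ℕ => c ^ n / (n - 1)!) atTop (nhds 0) := by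
  rw [← tendsto_add_atTop_iff_nat 1, ← mul_zero c]
  refine ((FloorSemiring.tendsto_pow_div_factorial_atTop c).const_mul c).congr fun n => ?_
  simp only [Nat.add_sub_cancel]
  ring

/-- Were the sum zero, a Hermite approximation at a large prime p would give an integer of absolute
value below 1, hence 0, yet not divisible by p. -/
theorem natCast_add_sum_exp_aroots_ne_zero (A : Type*) [Field A] [Algebra ℚ A]
    [IsAlgClosure ℚ A] [Algebra A ℂ] (f : ℤ[X]) (hf : f.eval 0 ≠ 0) {k : ℕ} (hk : k ≠ 0) :
    (k : ℂ) + ((f.aroots ℂ).map Complex.exp).sum ≠ 0 := by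
  intro h0
  have hf0 : f ≠ 0 := by rintro rfl; simp at hf
  obtain ⟨c, hc⟩ := LindemannWeierstrass.exp_polynomial_approx f hf
  set l := f.leadingCoeff with hl
  set d := f.natDegree with hd
  set N := Multiset.card (f.aroots ℂ) with hN
  have hlim : Tendsto (fun p : ℕ => (N : ℝ) * ((|(l : ℝ)| ^ d * c) ^ p / (p - 1)!)) atTop (nhds 0) := by
    simpa using (tendsto_pow_div_factorial_pred (|(l : ℝ)| ^ d * c)).const_mul (N : ℝ)
  obtain ⟨P, hP⟩ := eventually_atTop.1 (hlim.eventually_lt_const one_pos)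
  -- `P` makes the error small, |f(0)| is the threshold of the approximation, and `k`, `l` must be
  -- prime to p.
  obtain ⟨p, hpge, hp⟩ :=
    Nat.exists_infinite_primes (P + (f.eval 0).natAbs + k + l.natAbs + 1)
  obtain ⟨n, hpn, g, hg, happ⟩ := hc p (by omega) hp
  obtain ⟨z, hz⟩ := exists_int_sum_aeval_aroots A f g (D := p * d) (hg.trans (Nat.sub_le _ _))
  set R := f.aroots ℂ
  have key : ((l ^ (p * d) * n * k + p * z : ℤ) : ℂ) =
      -((l : ℂ) ^ (p * d) * (R.map fun r => n • Complex.exp r - p • aeval r g).sum) := by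
    have h1 : (R.map fun r => n • Complex.exp r - p • aeval r g).sum =
        n * (R.map Complex.exp).sum - p * (R.map fun r => aeval r g).sum := by
      rw [← Multiset.sum_map_mul_left, ← Multiset.sum_map_mul_left, ← Multiset.sum_map_sub]
      simp
    rw [h1]
    push_cast
    rw [hz]
    linear_combination (l : ℂ) ^ (p * d) * n * h0
  have hsum : ‖(R.map fun r => n • Complex.exp r - p • aeval r g).sum‖ ≤
      N * (c ^ p / (p - 1)!) := by
    refine (norm_multiset_sum_le _).trans ?_
    rw [Multiset.map_map]
    refine (Multiset.sum_le_card_nsmul _ (c ^ p / (p - 1)!) fun y hy => ?_).trans ?_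
    · obtain ⟨r, hr, rfl⟩ := Multiset.mem_map.1 hy
      exact happ hr
    · simp [hN]
  have hlt : ‖((l ^ (p * d) * n * k + p * z : ℤ) : ℂ)‖ < 1 := by
    rw [key, norm_neg, norm_mul, norm_pow, Complex.norm_intCast]
    calc _ ≤ |(l : ℝ)| ^ (p * d) * (N * (c ^ p / (p - 1)!)) := by gcongr
      _ = N * ((|(l : ℝ)| ^ d * c) ^ p / (p - 1)!) := by rw [mul_pow, ← pow_mul, mul_comm d p]; ring
      _ < 1 := hP p (by omega)
  rw [Complex.norm_intCast] at hlt
  have hzero : l ^ (p * d) * n * k + p * z = 0 := Int.abs_lt_one_iff.1 (by exact_mod_cast hlt)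
  have hdvd : (p : ℤ) ∣ l ^ (p * d) * n * k := ⟨-z, by linear_combination hzero⟩
  have hpi : Prime (p : ℤ) := Nat.prime_iff_prime_int.1 hp
  rcases hpi.dvd_or_dvd hdvd with h | h
  · rcases hpi.dvd_or_dvd h with h | h
    · have := Nat.le_of_dvd (Int.natAbs_pos.2 (leadingCoeff_ne_zero.2 hf0))
        (Int.natCast_dvd.1 (hpi.dvd_of_dvd_pow h))
      omega
    · exact hpn h
  · have := Nat.le_of_dvd (Nat.pos_of_ne_zero hk) (Int.natCast_dvd_natCast.1 h)
    omega

/-- The zeros in `M` contribute the positive integer `M.count 0`; the other elements are the roots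
of an integer polynomial. -/
lemma sum_map_exp_ne_zero_of_galois_invariant {A : Type*} [Field A] [Algebra ℚ A]
    [IsAlgClosure ℚ A] [Algebra A ℂ] (M : Multiset A)
    (hM : ∀ σ : A ≃ₐ[ℚ] A, M.map σ = M) (h0 : 0 ∈ M) :
    (M.map fun a => Complex.exp (algebraMap _ ℂ a)).sum ≠ 0 := by
  classical
  obtain ⟨f, hf, hroots⟩ := exists_polynomial_aroots_eq_of_galois_invariant
    (M.filter (· ≠ 0)) fun σ => by
      conv_rhs => rw [← hM σ, Multiset.filter_map]
      congr 2
      ext a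
      simp
  have hsplit : (f.map (algebraMap ℤ A)).Splits := by
    have := IsAlgClosure.isAlgClosed ℚ (K := A)
    exact IsAlgClosed.splits _
  have hf0 : f.eval 0 ≠ 0 := by
    have := algebraRat.charZero A
    intro h
    have : (0 : A) ∈ f.aroots A := by
      rw [mem_aroots]
      refine ⟨hf, ?_⟩
      rw [← map_zero (algebraMap ℤ A), aeval_algebraMap_apply]
      simp [h]
    rw [hroots] at this
    simp at this
  have := natCast_add_sum_exp_aroots_ne_zero A f hf0 (k := M.count 0)
    (Multiset.count_pos.2 h0).ne'
  rw [← hsplit.map_aroots_algebraMap (B := ℂ), hroots, Multiset.map_map] at this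
  convert this using 1
  conv_lhs => rw [← Multiset.filter_add_not (· = 0) M, Multiset.map_add, Multiset.sum_add]
  congr 1
  have h : M.filter (· = 0) = Multiset.replicate (M.count 0) 0 := by
    convert Multiset.filter_eq' M 0
  rw [h]
  simp

lemma exp_algebraMap_ne_neg_one {A : Type*} [Field A] [Algebra ℚ A]
    [IsAlgClosure ℚ A] [Algebra A ℂ] (a : A) : Complex.exp (algebraMap A ℂ a) ≠ -1 := by
  classical
  intro hexp
  have ha : IsIntegral ℚ a :=
    ((IsAlgClosure.isAlgebraic (R := ℚ) (K := A)).isAlgebraic a).isIntegral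
  let T : Finset A := ((minpoly ℚ a).aroots A).toFinset
  have haT : a ∈ T := by
    simp [T, minpoly.ne_zero ha]
  have hT (σ : A ≃ₐ[ℚ] A) : T.map σ.toEmbedding = T := by
    refine Finset.eq_of_subset_of_card_le (fun x hx => ?_) (by simp)
    obtain ⟨y, hy, rfl⟩ := Finset.mem_map.1 hx
    simp only [T, Multiset.mem_toFinset, mem_aroots] at hy ⊢
    refine ⟨hy.1, ?_⟩
    change aeval (σ y) _ = 0
    rw [aeval_algHom_apply, hy.2, map_zero]
  -- Subset sums of the conjugates, with multiplicity; the empty subset provides 0.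
  refine sum_map_exp_ne_zero_of_galois_invariant
    (T.powerset.val.map fun S => ∑ b ∈ S, b) (fun σ => ?_) ?_ ?_
  · rw [Multiset.map_map]
    have h : T.powerset.map (Finset.mapEmbedding σ.toEmbedding).toEmbedding = T.powerset := by
      refine Finset.eq_of_subset_of_card_le (fun S hS => ?_) (by simp)
      obtain ⟨S', hS', rfl⟩ := Finset.mem_map.1 hS
      rw [Finset.mem_powerset] at hS' ⊢
      rw [← hT σ]
      exact Finset.map_subset_map.2 hS'
    conv_rhs => rw [← h, Finset.map_val, Multiset.map_map]
    congr 1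
    ext S
    simp
  · exact Multiset.mem_map.2 ⟨∅, by simp, by simp⟩
  · rw [Multiset.map_map]
    change ∑ S ∈ T.powerset, Complex.exp (algebraMap _ ℂ (∑ b ∈ S, b)) = 0
    simp_rw [map_sum, Complex.exp_sum]
    rw [← Finset.prod_one_add]
    refine Finset.prod_eq_zero haT ?_
    rw [hexp]
    ring

theorem exp_ne_neg_one_of_isAlgebraic {α : ℂ} (hα : IsAlgebraic ℚ α) : Complex.exp α ≠ -1 := by
  exact @exp_algebraMap_ne_neg_one (algebraicClosure ℚ ℂ) _ (algebraicClosure ℚ ℂ).algebra' _ _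
    ⟨α, mem_algebraicClosure_iff.2 hα⟩

theorem transcendental_pi : Transcendental ℚ Real.pi := by
  intro h
  have h1 : IsAlgebraic ℚ (Real.pi : ℂ) := h.algebraMap
  have h2 : IsAlgebraic ℚ Complex.I := by
    refine ⟨X ^ 2 + 1, (monic_X_pow_add_C (1 : ℚ) two_ne_zero).ne_zero, by simp⟩
  exact exp_ne_neg_one_of_isAlgebraic (h1.mul h2) Complex.exp_pi_mul_I

end Exponential

lemma irrational_ratCast_mul_pi_pow {q : ℚ} (hq : q ≠ 0) {m : ℕ} (hm : 0 < m) :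
    Irrational (q * Real.pi ^ m) := by
  rw [irrational_ratCast_mul_iff]
  exact ⟨hq, (transcendental_pi.pow hm).irrational⟩

/-! ### Euler numbers from Bernoulli polynomials at 1/4 -/

section EulerNumbers

open PowerSeries

lemma two_smul_coshSeries : (2 : ℚ) • coshSeries = exp ℚ + evalNegHom (exp ℚ) := by
  ext n
  rcases Nat.even_or_odd n with h | h
  · simp [coshSeries, evalNegHom, coeff_rescale, coeff_exp, h, h.neg_one_pow]
    ring
  · simp [coshSeries, evalNegHom, coeff_rescale, coeff_exp, h.neg_one_pow,
      Nat.not_even_iff_odd.2 h]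

lemma coshSeries_mul_inv : coshSeries * coshSeries⁻¹ = 1 :=
  PowerSeries.mul_inv_cancel _ (by
    rw [← coeff_zero_eq_constantCoeff_apply]; simp [coshSeries])

lemma rescale_coshSeries_mul :
    rescale (1 / 4 : ℚ) coshSeries * (2 * rescale (1 / 4 : ℚ) (exp ℚ)) =
      rescale (1 / 2 : ℚ) (exp ℚ) + 1 := by
  have h := congrArg (rescale (1 / 4 : ℚ)) two_smul_coshSeries
  have h1 : rescale (1 / 4 : ℚ) ((2 : ℚ) • coshSeries) = 2 * rescale (1 / 4 : ℚ) coshSeries := by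
    rw [two_smul, two_mul, map_add]
  have h2 : rescale (1 / 4 : ℚ) (evalNegHom (exp ℚ)) * rescale (1 / 4 : ℚ) (exp ℚ) = 1 := by
    rw [← map_mul, mul_comm, exp_mul_exp_neg_eq_one, map_one]
  have h3 : rescale (1 / 4 : ℚ) (exp ℚ) * rescale (1 / 4 : ℚ) (exp ℚ) =
      rescale (1 / 2 : ℚ) (exp ℚ) := by
    rw [exp_mul_exp_eq_exp_add]; norm_num
  rw [h1, map_add] at h
  linear_combination rescale (1 / 4 : ℚ) (exp ℚ) * h + h2 + h3

/-- With E = exp(t/4), (E³ - E)/(E⁴ - 1) = 1/(E + E⁻¹) = 1/(2 cosh(t/4)). -/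
lemma bernoulli_generating_function_quarter_sub :
    (2 : ℚ⟦X⟧) * ((PowerSeries.mk fun n => (1 / n ! : ℚ) * (Polynomial.bernoulli n).eval (3 / 4)) -
      PowerSeries.mk fun n => (1 / n ! : ℚ) * (Polynomial.bernoulli n).eval (1 / 4)) =
    X * rescale (1 / 4 : ℚ) coshSeries⁻¹ := by
  have hB (t : ℚ) := Polynomial.bernoulli_generating_function (A := ℚ) t
  have hB' (t : ℚ) : (PowerSeries.mk fun n => (1 / n ! : ℚ) * (Polynomial.bernoulli n).eval t) *
      (exp ℚ - 1) = X * rescale t (exp ℚ) := by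
    rw [← hB t]
    congr 2
    ext n
    simp [Polynomial.aeval_def]
  set E := rescale (1 / 4 : ℚ) (exp ℚ) with hE
  have e2 : rescale (1 / 2 : ℚ) (exp ℚ) = E * E := by
    rw [hE, exp_mul_exp_eq_exp_add]; norm_num
  have e3 : rescale (3 / 4 : ℚ) (exp ℚ) = E * E * E := by
    rw [← e2, hE, exp_mul_exp_eq_exp_add]; norm_num
  have e4 : exp ℚ = E * E * (E * E) := by
    rw [← e2, exp_mul_exp_eq_exp_add]; norm_num
  have hc : rescale (1 / 4 : ℚ) coshSeries * rescale (1 / 4 : ℚ) coshSeries⁻¹ = 1 := by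
    rw [← map_mul, coshSeries_mul_inv, map_one]
  have hr := rescale_coshSeries_mul
  rw [e2, ← hE] at hr
  have hne : exp ℚ - 1 ≠ 0 := by
    intro h
    have := congrArg (coeff 1) h
    simp [coeff_exp, coeff_one] at this
  refine mul_right_cancel₀ hne ?_
  have h1 := hB' (1 / 4)
  have h3 := hB' (3 / 4)
  rw [e3] at h3
  rw [← hE] at h1
  set c := rescale (1 / 4 : ℚ) coshSeries⁻¹
  rw [mul_assoc, sub_mul, h1, h3, e4]
  linear_combination X * (E * E - 1) * (c * hr - 2 * E * hc)

lemma bernoulli_eval_one_quarter (k : ℕ) :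
    (Polynomial.bernoulli (2 * k + 1)).eval (1 / 4 : ℚ) =
      -((2 * k + 1) * eulerNumber (2 * k) / 4 ^ (2 * k + 1)) := by
  have h := congrArg (coeff (2 * k + 1)) bernoulli_generating_function_quarter_sub
  have h2 : (2 : ℚ⟦X⟧) = C 2 := (map_ofNat C 2).symm
  -- Reflection at odd index turns the value at 3/4 into minus the value at 1/4.
  have hs := Polynomial.bernoulli_eval_one_sub (2 * k + 1) (1 / 4)
  rw [Odd.neg_one_pow ⟨k, rfl⟩, show (1 - 1 / 4 : ℚ) = 3 / 4 by norm_num] at hs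
  rw [h2, coeff_C_mul, map_sub, coeff_mk, coeff_mk, coeff_succ_X_mul, coeff_rescale, hs,
    Nat.factorial_succ] at h
  rw [eulerNumber]
  have : ((2 * k)! : ℚ) ≠ 0 := by positivity
  push_cast at h
  rw [one_div_pow] at h
  rw [pow_succ]
  field_simp at h ⊢
  linear_combination -h

end EulerNumbers

/-! ### Special values and their irrationality -/

lemma quadraticChar4_natCast (k : ℕ) :
    quadraticChar4 (k : ZMod 4) = (Real.sin (2 * Real.pi * k * (1 / 4)) : ℂ) := by
  have hsin : Real.sin (2 * Real.pi * k * (1 / 4)) = ((ZMod.χ₄ (k : ZMod 4) : ℤ) : ℝ) := by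
    rw [ZMod.χ₄_nat_mod_four]
    have hk : (k : ℝ) = 4 * (k / 4 : ℕ) + (k % 4 : ℕ) := by exact_mod_cast (Nat.div_add_mod k 4).symm
    rw [show 2 * Real.pi * k * (1 / 4) = (k % 4 : ℕ) * (Real.pi / 2) + (k / 4 : ℕ) * (2 * Real.pi)
      by rw [hk]; simp; ring, Real.sin_add_nat_mul_two_pi]
    have : k % 4 < 4 := Nat.mod_lt _ (by norm_num)
    interval_cases k % 4
    · simp
    · simp
    · simp [show (2 : ℝ) * (Real.pi / 2) = Real.pi by ring]
    · rw [show ((3 : ℕ) : ℝ) * (Real.pi / 2) = Real.pi / 2 + Real.pi by push_cast; ring,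
        Real.sin_add_pi, Real.sin_pi_div_two, show ZMod.χ₄ ((3 : ℕ) : ZMod 4) = -1 from rfl]
      simp
  rw [hsin]
  simp [quadraticChar4, MulChar.ringHomComp_apply]

theorem LSeriesHasSum_quadraticChar4 {n : ℕ} (hn : n ≠ 0) :
    LSeriesHasSum (fun k : ℕ => quadraticChar4 (k : ZMod 4)) (2 * n + 1 : ℂ)
      (((-1) ^ n * Real.pi ^ (2 * n + 1) * (eulerNumber (2 * n) : ℝ) /
        (2 ^ (2 * n + 2) * ((2 * n)! : ℝ)) : ℝ) : ℂ) := by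
  have h := hasSum_one_div_nat_pow_mul_sin hn (x := 1 / 4) (by constructor <;> norm_num)
  have hval : (Polynomial.map (algebraMap ℚ ℝ) (Polynomial.bernoulli (2 * n + 1))).eval (1 / 4) =
      -((2 * n + 1) * (eulerNumber (2 * n) : ℝ) / 4 ^ (2 * n + 1)) := by
    rw [show (1 / 4 : ℝ) = algebraMap ℚ ℝ (1 / 4) by simp, Polynomial.eval_map,
      Polynomial.eval₂_at_apply, bernoulli_eval_one_quarter]
    simp
  rw [hval] at h
  unfold LSeriesHasSum
  convert Complex.hasSum_ofReal.2 h using 1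
  · ext k
    -- At `k = 0` both terms vanish: `LSeries.term` by convention, the other since sin 0 = 0.
    rcases eq_or_ne k 0 with rfl | hk
    · simp
    · rw [LSeries.term_of_ne_zero hk, quadraticChar4_natCast,
        show (2 * n + 1 : ℂ) = ((2 * n + 1 : ℕ) : ℂ) by push_cast; rfl, Complex.cpow_natCast]
      push_cast
      ring
  · congr 1
    rw [Nat.factorial_succ, show (4 : ℝ) = 2 * 2 by norm_num, mul_pow, mul_pow]
    have : ((2 * n)! : ℝ) ≠ 0 := by positivity
    push_cast
    field_simp
    ring

theorem riemannZeta_two_mul_eq {n : ℕ} (hn : n ≠ 0) :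
    riemannZeta (2 * n : ℂ) =
      (((-1) ^ (n + 1) * (2 * Real.pi) ^ (2 * n) * (bernoulli (2 * n) : ℝ) /
        (2 * ((2 * n)! : ℝ)) : ℝ) : ℂ) := by
  rw [riemannZeta_two_mul_nat hn]
  obtain ⟨m, rfl⟩ := Nat.exists_eq_add_one_of_ne_zero hn
  push_cast
  rw [mul_pow, show 2 * (m + 1) - 1 = 2 * m + 1 by omega, show 2 * (m + 1) = 2 * m + 2 by ring]
  ring

lemma bernoulli_two_mul_ne_zero {n : ℕ} (hn : n ≠ 0) : bernoulli (2 * n) ≠ 0 := by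
  intro h
  refine riemannZeta_ne_zero_of_one_lt_re (s := 2 * n) ?_ ?_
  · norm_cast
    omega
  · rw [riemannZeta_two_mul_eq hn, h]
    simp

lemma eulerNumber_two_mul_ne_zero {n : ℕ} (hn : n ≠ 0) : eulerNumber (2 * n) ≠ 0 := by
  intro h
  refine DirichletCharacter.LSeries_ne_zero_of_one_lt_re quadraticChar4 (s := 2 * n + 1) ?_ ?_
  · norm_cast
    omega
  · rw [(LSeriesHasSum_quadraticChar4 hn).LSeries_eq, h]
    simp

theorem theorem17 (n : ℕ) (hn : 1 ≤ n) :
    (riemannZeta (2 * n : ℂ) =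
        (((-1) ^ (n + 1) * (2 * Real.pi) ^ (2 * n) * (bernoulli (2 * n) : ℝ) /
          (2 * ((2 * n)! : ℝ)) : ℝ) : ℂ) ∧
      Irrational ((-1) ^ (n + 1) * (2 * Real.pi) ^ (2 * n) * (bernoulli (2 * n) : ℝ) /
          (2 * ((2 * n)! : ℝ)))) ∧
    (LSeriesHasSum (fun k : ℕ => quadraticChar4 (k : ZMod 4)) (2 * n + 1 : ℂ)
        (((-1) ^ n * Real.pi ^ (2 * n + 1) * (eulerNumber (2 * n) : ℝ) /
          (2 ^ (2 * n + 2) * ((2 * n)! : ℝ)) : ℝ) : ℂ) ∧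
      Irrational ((-1) ^ n * Real.pi ^ (2 * n + 1) * (eulerNumber (2 * n) : ℝ) /
          (2 ^ (2 * n + 2) * ((2 * n)! : ℝ)))) := by
  have hn0 : n ≠ 0 := Nat.one_le_iff_ne_zero.1 hn
  refine ⟨⟨riemannZeta_two_mul_eq hn0, ?_⟩, LSeriesHasSum_quadraticChar4 hn0, ?_⟩
  · have hq : ((-1) ^ (n + 1) * 2 ^ (2 * n) * bernoulli (2 * n) / (2 * (2 * n)!) : ℚ) ≠ 0 := by
      have := bernoulli_two_mul_ne_zero hn0
      positivity
    convert irrational_ratCast_mul_pi_pow hq (m := 2 * n) (by omega) using 1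
    push_cast
    ring
  · have hq : ((-1) ^ n * eulerNumber (2 * n) / (2 ^ (2 * n + 2) * (2 * n)!) : ℚ) ≠ 0 := by
      have := eulerNumber_two_mul_ne_zero hn0
      positivity
    convert irrational_ratCast_mul_pi_pow hq (m := 2 * n + 1) (by omega) using 1
    push_cast
    ring
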